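/- Let $\mathbb{E}$ be a finite-dimensional real vector space with dual $\mathbb{E}^*$, and let $f$ be an $M_f$-self-concordant function, $M_f\ge 0$: its domain $\mathrm{dom} f\subseteq\mathbb{E}$ is open and convex (for instance $\mathrm{dom} f=\mathbb{E}$), $f$ is convex and three times continuously differentiable on $\mathrm{dom} f$, it is closed, that is, all its sublevel sets $\{y\in\mathrm{dom} f : f(y)\le a\}$ are closed in $\mathbb{E}$ (automatic if $\mathrm{dom} f=\mathbb{E}$), and $$|D^3f(y)[v]^3|\le 2M_f\langle\nabla^2 f(y)v,v\rangle^{3/2}\qquad\text{for all } y\in\mathrm{dom} f,\ v\in\mathbb{E}.$$ Assume that $\nabla^2 f(y)$ is positive definite for every $y\in\mathrm{dom} f$. For a function $g$ with nondegenerate positive semidefinite Hessian at $y$, write $\lambda_g(y)=\langle \nabla g(y),[\nabla^2 g(y)]^{-1}\nabla g(y)\rangle^{1/2}$. For $s\in\mathbb{E}^*$ and $v\in\mathbb{E}$ write $\|v\|_x=\langle\nabla^2 f(x)v,v\rangle^{1/2}$ and $\|s\|_x^*=\langle s,[\nabla^2 f(x)]^{-1}s\rangle^{1/2}$. Let $c\in\mathbb{E}^*$,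 let $f_t(y)=f(y)+t\langle c,y\rangle$ for $t\in\mathbb{R}$, let $x\in\mathrm{dom} f$, and put $h=[\nabla^2 f(x)]^{-1}c$ and $r=\|h\|_x$. Then $r=\|c\|_x^*$, and for all $t\in\mathbb{R}$ and all $\tau\in\mathbb{R}$ with $|\tau|M_f r<1$ one has $x+\tau h\in\mathrm{dom} f$ and $$\lambda_{f_{t-\tau}}(x+\tau h)\le\lambda_{f_t}(x)\left(1+\frac{|\tau|M_f r}{1-|\tau|M_f r}\right)+\frac{1}{M_f}\left(\frac{|\tau|M_f r}{1-|\tau|M_f r}\right)^2,$$ where the last term is read as $0$ (its limit) if $M_f=0$. -/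

import Mathlib

noncomputable section

namespace SelfConcordance

variable {E : Type*} [NormedAddCommGroup E] [NormedSpace ℝ E]

/-- The Hessian of `f` at `x` as a linear map from `E` to its dual, so that
`hessian f x u v` is `⟨∇²f(x) u, v⟩`. The gradient `∇f(x)` is `fderiv ℝ f x`. -/
def hessian (f : E → ℝ) (x : E) : E →L[ℝ] (E →L[ℝ] ℝ) :=
  fderiv ℝ (fderiv ℝ f) x

/-- The third derivative of `f` at `x`: `thirdDeriv f x h u v` is `⟨D³f(x)[h] u, v⟩`. -/
def thirdDeriv (f : E → ℝ) (x : E) : E →L[ℝ] (E →L[ℝ] (E →L[ℝ] ℝ)) :=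
  fderiv ℝ (hessian f) x

/-- The inverse Hessian `[∇²f(x)]⁻¹`, from the dual of `E` to `E`
(it is the zero map where the Hessian is not invertible). -/
def invHessian (f : E → ℝ) (x : E) : (E →L[ℝ] ℝ) →L[ℝ] E :=
  (hessian f x).inverse

/-- The local norm `‖h‖_x = ⟨∇²f(x) h, h⟩^{1/2}`. -/
def localNorm (f : E → ℝ) (x h : E) : ℝ :=
  Real.sqrt (hessian f x h h)

/-- The dual local norm `‖g‖*_x = ⟨g, [∇²f(x)]⁻¹ g⟩^{1/2}`. -/
def dualNorm (f : E → ℝ) (x : E) (g : E →L[ℝ] ℝ) : ℝ :=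
  Real.sqrt (g (invHessian f x g))

/-- The Newton decrement `λ_f(x) = ‖∇f(x)‖*_x`. -/
def newtonDecrement (f : E → ℝ) (x : E) : ℝ :=
  dualNorm f x (fderiv ℝ f x)

/-- The parametric family `f_t(y) = f(y) + t ⟨c, y⟩`. -/
def pathFunction (f : E → ℝ) (c : E →L[ℝ] ℝ) (t : ℝ) : E → ℝ :=
  fun y => f y + t * c y

/-- `f` is an `M`-self-concordant function with domain `Q`: the domain is open, `f` is convex and
three times continuously differentiable on it and
`|D³f(x)[h]³| ≤ 2 M ⟨∇²f(x) h, h⟩^{3/2}` there. The function is regarded as `+∞` outside `Q`, and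
it is closed, that is, its sublevel sets are closed in `E`; for `Q = E` this is just continuity.
The values of `f` outside `Q` play no role. -/
structure IsSelfConcordantOn (Q : Set E) (f : E → ℝ) (M : ℝ) : Prop where
  nonneg : 0 ≤ M
  isOpen : IsOpen Q
  convexOn : ConvexOn ℝ Q f
  contDiffOn : ContDiffOn ℝ 3 f Q
  isClosed_sublevel : ∀ a : ℝ, IsClosed {y | y ∈ Q ∧ f y ≤ a}
  abs_thirdDeriv_le : ∀ x ∈ Q, ∀ h : E,
    |thirdDeriv f x h h h| ≤ 2 * M * (hessian f x h h) ^ (3 / 2 : ℝ)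

end SelfConcordance

end

/-! Since `∇²f(x) h = c`, moving from `x` to `x + τh` changes the gradient of `f` by `τc` to first
order, and replacing `t` by `t - τ` cancels exactly that term. What remains is `∇f_t(x)` plus the
linearization error of `∇f`. With `ρ = M|τ|r`, `abs_fderiv_sub_le` bounds this error in the dual
norm at `x` by `M(|τ|r)²/(1-ρ)`, and by `localNorm_line_bounds` passing to the dual norm at `x + τh`
costs a factor `1/(1-ρ)`. The sum is the stated bound.

Both estimates need mixed third derivatives, while self-concordance controls only the diagonal.
Banach's polarization for Euclidean norms (`abs_trilinear_le`) closes this gap without losing the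
constant `2M`; integrating along the segment then gives hyperbolic rates. That the segment stays in
the domain (`add_smul_mem`) follows from closedness of the sublevel sets. -/

noncomputable section

/-! ### Polarization of symmetric trilinear forms -/

/-- A Bernstein–Szegő type bound: interpolation at three nodes with nonnegative weights bounds the
polarization of a binary cubic form by its values on the unit circle. -/
lemma binary_cubic_polarization_le {a b c d K : ℝ}
    (hK : ∀ C S : ℝ, C ^ 2 + S ^ 2 = 1 →
      a * C ^ 3 + 3 * b * C ^ 2 * S + 3 * c * C * S ^ 2 + d * S ^ 3 ≤ K)
    {p q : ℝ} (hpq : p ^ 2 + q ^ 2 = 1) : a * p + b * q ≤ K := by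
  obtain ⟨g, rfl, rfl⟩ : ∃ g : ℝ, p = Real.cos (3 * g) ∧ q = Real.sin (3 * g) := by
    have h1 : ‖(⟨p, q⟩ : ℂ)‖ = 1 := by
      rw [Complex.norm_def, Complex.normSq_mk, Real.sqrt_eq_one]; linarith
    have h0 : (⟨p, q⟩ : ℂ) ≠ 0 := by rw [← norm_ne_zero_iff, h1]; exact one_ne_zero
    refine ⟨Complex.arg ⟨p, q⟩ / 3, ?_, ?_⟩
    · rw [mul_div_cancel₀ _ (by norm_num), Complex.cos_arg h0, h1]; simp
    · rw [mul_div_cancel₀ _ (by norm_num), Complex.sin_arg, h1]; simp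
  rw [Real.cos_three_mul, Real.sin_three_mul]
  have hCS := Real.cos_sq_add_sin_sq g
  set C := Real.cos g
  set S := Real.sin g
  -- The nodes are the three angles `θ` with `3θ = 3g` modulo `2π`, namely `g` and `g ± 2π/3`; the
  -- weights are `(1 + 2 cos 2θ)²`, with sum `9`.
  obtain ⟨z, hz⟩ : ∃ z : ℝ, z ^ 2 = 3 := ⟨√3, Real.sq_sqrt (by norm_num)⟩
  clear_value C S
  have e0 := hK C S hCS
  have e1 := hK (-C / 2 - z * S / 2) (-S / 2 + z * C / 2) (by grind)
  have e2 := hK (-C / 2 + z * S / 2) (-S / 2 - z * C / 2) (by grind)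
  have w0 := mul_le_mul_of_nonneg_left e0 (sq_nonneg (1 + 2 * (C ^ 2 - S ^ 2)))
  have w1 := mul_le_mul_of_nonneg_left e1 (sq_nonneg (1 - (C ^ 2 - S ^ 2) + z * (2 * S * C)))
  have w2 := mul_le_mul_of_nonneg_left e2 (sq_nonneg (1 - (C ^ 2 - S ^ 2) - z * (2 * S * C)))
  have hs : (1 + 2 * (C ^ 2 - S ^ 2)) ^ 2 + (1 - (C ^ 2 - S ^ 2) + z * (2 * S * C)) ^ 2 +
    (1 - (C ^ 2 - S ^ 2) - z * (2 * S * C)) ^ 2 = 9 := by grind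
  have key : 9 * (a * (4 * C ^ 3 - 3 * C) + b * (3 * S - 4 * S ^ 3)) =
      (1 + 2 * (C ^ 2 - S ^ 2)) ^ 2 *
        (a * C ^ 3 + 3 * b * C ^ 2 * S +
          3 * c * C * S ^ 2 + d * S ^ 3) +
      (1 - (C ^ 2 - S ^ 2) + z * (2 * S * C)) ^ 2 *
        (a * (-C / 2 - z * S / 2) ^ 3 + 3 * b * (-C / 2 - z * S / 2) ^ 2 * (-S / 2 + z * C / 2) +
          3 * c * (-C / 2 - z * S / 2) * (-S / 2 + z * C / 2) ^ 2 + d * (-S / 2 + z * C / 2) ^ 3) +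
      (1 - (C ^ 2 - S ^ 2) - z * (2 * S * C)) ^ 2 *
        (a * (-C / 2 + z * S / 2) ^ 3 + 3 * b * (-C / 2 + z * S / 2) ^ 2 * (-S / 2 - z * C / 2) +
          3 * c * (-C / 2 + z * S / 2) * (-S / 2 - z * C / 2) ^ 2 + d * (-S / 2 - z * C / 2) ^ 3) := by
    grind
  linear_combination (w0 + w1 + w2 + key + K * hs) / 9

lemma posForm_sq_le {E : Type*} [NormedAddCommGroup E] [NormedSpace ℝ E]
    {A : E →L[ℝ] (E →L[ℝ] ℝ)} (hsymm : ∀ u v, A u v = A v u) (hnonneg : ∀ v, 0 ≤ A v v)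
    (u v : E) : (A u v) ^ 2 ≤ A u u * A v v := by
  have := LinearMap.BilinForm.apply_sq_le_of_symm
    (B := (ContinuousLinearMap.coeLM ℝ).comp (A : E →ₗ[ℝ] (E →L[ℝ] ℝ))) hnonneg
    ⟨fun x y => by simpa using hsymm x y⟩ u v
  simpa using this

lemma posForm_abs_le {E : Type*} [NormedAddCommGroup E] [NormedSpace ℝ E]
    {A : E →L[ℝ] (E →L[ℝ] ℝ)} (hsymm : ∀ u v, A u v = A v u) (hnonneg : ∀ v, 0 ≤ A v v)
    (u v : E) : |A u v| ≤ √(A u u) * √(A v v) := by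
  rw [← Real.sqrt_mul (hnonneg u)]
  exact Real.abs_le_sqrt (posForm_sq_le hsymm hnonneg u v)

/-- Banach's polarization bound for a symmetric trilinear form that is controlled on the diagonal
by a Euclidean norm, at unit vectors. -/
lemma trilinear_le_of_unit {E : Type*} [NormedAddCommGroup E] [NormedSpace ℝ E]
    {A : E →L[ℝ] (E →L[ℝ] ℝ)} (hsymm : ∀ u v, A u v = A v u) (hpos : ∀ v, v ≠ 0 → 0 < A v v)
    {T : E →L[ℝ] (E →L[ℝ] (E →L[ℝ] ℝ))} (h12 : ∀ u v w, T u v w = T v u w)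
    (h23 : ∀ u v w, T u v w = T u w v) {K : ℝ} (hK : 0 ≤ K)
    (hT : ∀ v, |T v v v| ≤ K * √(A v v) ^ 3) {u v : E} (hu : A u u = 1) (hv : A v v = 1) :
    T u v v ≤ K := by
  have hnonneg : ∀ w, 0 ≤ A w w := fun w => by
    rcases eq_or_ne w 0 with rfl | hw
    · simp
    · exact (hpos w hw).le
  set p := A u v with hp
  have hp1 : p ^ 2 ≤ 1 := by simpa [hu, hv] using posForm_sq_le hsymm hnonneg u v
  set q := √(1 - p ^ 2) with hq
  have hq2 : q ^ 2 = 1 - p ^ 2 := Real.sq_sqrt (by linarith)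
  set w := u - p • v with hw
  have hww : A w w = q ^ 2 := by
    simp only [hw, map_sub, map_smul, _root_.sub_apply, _root_.smul_apply,
      smul_eq_mul, hu, hv, hsymm v u, ← hp, hq2]
    ring
  have hvw : A v w = 0 := by
    simp only [hw, map_sub, map_smul, smul_eq_mul, hv, hsymm v u, ← hp]
    ring
  -- `e` is the unit vector along the part of `u` orthogonal to `v`, or `0` if that part vanishes;
  -- hence only `A e e ≤ 1`.
  obtain ⟨e, hqe, hve, hee⟩ : ∃ e : E, w = q • e ∧ A v e = 0 ∧ A e e ≤ 1 := by
    rcases eq_or_ne q 0 with h0 | h0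
    · refine ⟨0, ?_, by simp, by simp⟩
      by_contra hne
      have := hpos w (by simpa using hne)
      simp [hww, h0] at this
    · refine ⟨q⁻¹ • w, by rw [smul_inv_smul₀ h0], by simp [hvw], ?_⟩
      simp only [map_smul, _root_.smul_apply, smul_eq_mul, hww]
      field_simp
      rfl
  have huve : u = p • v + q • e := by rw [← hqe, hw]; abel
  have hdiag : ∀ C S : ℝ, C ^ 2 + S ^ 2 = 1 →
      T v v v * C ^ 3 + 3 * T e v v * C ^ 2 * S + 3 * T e e v * C * S ^ 2 + T e e e * S ^ 3 ≤ K := by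
    intro C S hCS
    have hn : A (C • v + S • e) (C • v + S • e) ≤ 1 := by
      simp only [map_add, map_smul, _root_.add_apply, _root_.smul_apply,
        smul_eq_mul, hv, hve, hsymm e v]
      nlinarith [mul_le_mul_of_nonneg_left hee (sq_nonneg S)]
    have hs : √(A (C • v + S • e) (C • v + S • e)) ^ 3 ≤ 1 :=
      pow_le_one₀ (Real.sqrt_nonneg _) (Real.sqrt_le_one.2 hn)
    have h1 := (le_abs_self _).trans ((hT (C • v + S • e)).trans (mul_le_of_le_one_right hK hs))
    refine le_trans (le_of_eq ?_) h1
    simp only [map_add, map_smul, _root_.add_apply, _root_.smul_apply,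
      smul_eq_mul, h12 v e v, h23 v v e, h23 e v e, h12 v e e]
    ring
  have := binary_cubic_polarization_le hdiag (p := p) (q := q) (by rw [hq2]; ring)
  calc T u v v = T v v v * p + T e v v * q := by
        rw [huve]
        simp only [map_add, map_smul, _root_.add_apply,
          _root_.smul_apply, smul_eq_mul]
        ring
    _ ≤ K := this

/-- Homogeneity reduces to unit vectors, and `u ↦ -u` gives the absolute value. -/
lemma abs_trilinear_le {E : Type*} [NormedAddCommGroup E] [NormedSpace ℝ E]
    {A : E →L[ℝ] (E →L[ℝ] ℝ)} (hsymm : ∀ u v, A u v = A v u) (hpos : ∀ v, v ≠ 0 → 0 < A v v)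
    {T : E →L[ℝ] (E →L[ℝ] (E →L[ℝ] ℝ))} (h12 : ∀ u v w, T u v w = T v u w)
    (h23 : ∀ u v w, T u v w = T u w v) {K : ℝ} (hK : 0 ≤ K)
    (hT : ∀ v, |T v v v| ≤ K * √(A v v) ^ 3) (u v : E) :
    |T u v v| ≤ K * √(A u u) * A v v := by
  suffices H : ∀ u, T u v v ≤ K * √(A u u) * A v v by
    refine abs_le.2 ⟨?_, H u⟩
    have := H (-u)
    simp only [map_neg, _root_.neg_apply, neg_neg] at this
    linarith
  intro u
  rcases eq_or_ne u 0 with rfl | hu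
  · simp
  rcases eq_or_ne v 0 with rfl | hv
  · simp
  have hunit : ∀ w, w ≠ 0 → A ((√(A w w))⁻¹ • w) ((√(A w w))⁻¹ • w) = 1 := fun w hw => by
    have h1 := Real.sq_sqrt (hpos w hw).le
    have h2 := (Real.sqrt_pos.2 (hpos w hw)).ne'
    simp only [map_smul, _root_.smul_apply, smul_eq_mul]
    field_simp
    exact h1.symm
  have := trilinear_le_of_unit hsymm hpos h12 h23 hK hT (hunit u hu) (hunit v hv)
  simp only [map_smul, _root_.smul_apply, smul_eq_mul] at this
  have hu' := Real.sqrt_pos.2 (hpos u hu)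
  have hv' := Real.sqrt_pos.2 (hpos v hv)
  have hv2 := Real.sq_sqrt (hpos v hv).le
  generalize √(A u u) = a at *
  generalize √(A v v) = b at *
  rw [← hv2]
  calc T u v v = (b⁻¹ * (b⁻¹ * (a⁻¹ * T u v v))) * (a * b ^ 2) := by field_simp
    _ ≤ K * (a * b ^ 2) := mul_le_mul_of_nonneg_right (by linarith) (by positivity)
    _ = _ := by ring

/-! ### Duality between the local norms -/

namespace SelfConcordance

/-- A positive definite Hessian in finite dimension is inverted by `invHessian`. -/
lemma hessian_invHessian {E : Type*} [NormedAddCommGroup E] [NormedSpace ℝ E]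
    [FiniteDimensional ℝ E] {f : E → ℝ} {x : E} (hpos : ∀ v, v ≠ 0 → 0 < hessian f x v v)
    (s : E →L[ℝ] ℝ) : hessian f x (invHessian f x s) = s := by
  have hinj : Function.Injective (hessian f x : E →ₗ[ℝ] (E →L[ℝ] ℝ)) := by
    refine (injective_iff_map_eq_zero _).2 fun v hv => ?_
    by_contra hne
    have := hpos v hne
    rw [show hessian f x v = 0 from hv] at this
    simp at this
  have hdim : Module.finrank ℝ E = Module.finrank ℝ (E →L[ℝ] ℝ) := by
    rw [← (LinearMap.toContinuousLinearMap (𝕜 := ℝ) (E := E) (F' := ℝ)).finrank_eq]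
    exact Subspace.dual_finrank_eq.symm
  let e : E ≃L[ℝ] (E →L[ℝ] ℝ) :=
    (LinearEquiv.ofInjectiveOfFinrankEq _ hinj hdim).toContinuousLinearEquiv
  have he : (e : E →L[ℝ] (E →L[ℝ] ℝ)) = hessian f x := by ext v w; rfl
  rw [invHessian, ← he, ContinuousLinearMap.inverse_equiv]
  exact e.apply_symm_apply s

/-- Testing `s` on its own representer `[∇²f(x)]⁻¹ s`, whose local norm is the dual norm of `s`,
gives `‖s‖*² ≤ C ‖s‖*`. -/
lemma dualNorm_le {E : Type*} [NormedAddCommGroup E] [NormedSpace ℝ E]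
    [FiniteDimensional ℝ E] {f : E → ℝ} {x : E} (hpos : ∀ v, v ≠ 0 → 0 < hessian f x v v)
    {s : E →L[ℝ] ℝ} {C : ℝ} (hC : 0 ≤ C) (hs : ∀ v, |s v| ≤ C * localNorm f x v) :
    dualNorm f x s ≤ C := by
  have h1 := hs (invHessian f x s)
  have h2 : localNorm f x (invHessian f x s) = dualNorm f x s := by
    rw [localNorm, dualNorm, hessian_invHessian hpos]
  rw [h2] at h1
  rcases (Real.sqrt_nonneg (s (invHessian f x s))).eq_or_lt with h0 | h0
  · rw [dualNorm, ← h0]; exact hC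
  · have h3 := Real.sq_sqrt (Real.sqrt_pos.1 h0).le
    change 0 < dualNorm f x s at h0
    change dualNorm f x s ^ 2 = _ at h3
    refine le_of_mul_le_mul_right ?_ h0
    rw [← sq, h3]
    exact (le_abs_self _).trans h1

/-- Cauchy–Schwarz for the Hessian form, applied to the representer of `s` and `v`. -/
lemma abs_apply_le_dualNorm_mul {E : Type*} [NormedAddCommGroup E] [NormedSpace ℝ E]
    [FiniteDimensional ℝ E] {f : E → ℝ} {x : E}
    (hsymm : ∀ u v, hessian f x u v = hessian f x v u)
    (hpos : ∀ v, v ≠ 0 → 0 < hessian f x v v) (s : E →L[ℝ] ℝ) (v : E) :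
    |s v| ≤ dualNorm f x s * localNorm f x v := by
  have := posForm_abs_le hsymm (fun w => by
    rcases eq_or_ne w 0 with rfl | hw
    · simp
    · exact (hpos w hw).le) (invHessian f x s) v
  rwa [hessian_invHessian hpos] at this

/-! ### Derivatives along lines and symmetry of the third derivative -/

section Calculus

variable {F : Type*} [NormedAddCommGroup F] [NormedSpace ℝ F] {Q : Set F} {f : F → ℝ} {M : ℝ}

lemma IsSelfConcordantOn.contDiffAt (hf : IsSelfConcordantOn Q f M) {y : F} (hy : y ∈ Q) :
    ContDiffAt ℝ 3 f y :=
  hf.contDiffOn.contDiffAt (hf.isOpen.mem_nhds hy)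

lemma IsSelfConcordantOn.contDiffAt_fderiv (hf : IsSelfConcordantOn Q f M) {y : F} (hy : y ∈ Q) :
    ContDiffAt ℝ 2 (fderiv ℝ f) y :=
  (hf.contDiffAt hy).fderiv_right (by norm_num)

lemma IsSelfConcordantOn.hasFDerivAt_fderiv (hf : IsSelfConcordantOn Q f M) {y : F} (hy : y ∈ Q) :
    HasFDerivAt (fderiv ℝ f) (hessian f y) y :=
  ((hf.contDiffAt_fderiv hy).differentiableAt (by norm_num)).hasFDerivAt

lemma IsSelfConcordantOn.hasFDerivAt_hessian (hf : IsSelfConcordantOn Q f M) {y : F}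
    (hy : y ∈ Q) : HasFDerivAt (hessian f) (thirdDeriv f y) y :=
  (((hf.contDiffAt_fderiv hy).fderiv_right (m := 1) (by norm_num)).differentiableAt
    (by norm_num)).hasFDerivAt

lemma IsSelfConcordantOn.hessian_symm (hf : IsSelfConcordantOn Q f M) {y : F} (hy : y ∈ Q)
    (u v : F) : hessian f y u v = hessian f y v u :=
  ((hf.contDiffAt hy).isSymmSndFDerivAt (by simp; norm_num)).eq u v

lemma IsSelfConcordantOn.thirdDeriv_symm₁₂ (hf : IsSelfConcordantOn Q f M) {y : F} (hy : y ∈ Q)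
    (u v w : F) : thirdDeriv f y u v w = thirdDeriv f y v u w :=
  congrArg (fun L => L w) (((hf.contDiffAt_fderiv hy).isSymmSndFDerivAt (by simp)).eq u v)

lemma IsSelfConcordantOn.hasDerivAt_hessian_line (hf : IsSelfConcordantOn Q f M) {x d : F} {s : ℝ}
    (hy : x + s • d ∈ Q) (u v : F) :
    HasDerivAt (fun s : ℝ => hessian f (x + s • d) u v) (thirdDeriv f (x + s • d) d u v) s := by
  have hl : HasDerivAt (fun s : ℝ => x + s • d) d s := by
    simpa using ((hasDerivAt_id s).smul_const d).const_add x
  have h1 : HasDerivAt (fun s : ℝ => hessian f (x + s • d)) (thirdDeriv f (x + s • d) d) s :=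
    HasFDerivAt.comp_hasDerivAt (E := F →L[ℝ] (F →L[ℝ] ℝ)) s (hf.hasFDerivAt_hessian hy) hl
  have h2 := (h1.clm_apply (hasDerivAt_const s u)).clm_apply (hasDerivAt_const s v)
  simpa using h2

lemma IsSelfConcordantOn.hasDerivAt_fderiv_line (hf : IsSelfConcordantOn Q f M) {x d : F} {s : ℝ}
    (hy : x + s • d ∈ Q) (v : F) :
    HasDerivAt (fun s : ℝ => fderiv ℝ f (x + s • d) v) (hessian f (x + s • d) d v) s := by
  have hl : HasDerivAt (fun s : ℝ => x + s • d) d s := by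
    simpa using ((hasDerivAt_id s).smul_const d).const_add x
  have h1 := (hf.hasFDerivAt_fderiv hy).comp_hasDerivAt s hl
  have h2 := h1.clm_apply (hasDerivAt_const s v)
  simpa using h2

lemma IsSelfConcordantOn.hasDerivAt_line (hf : IsSelfConcordantOn Q f M) {x d : F} {s : ℝ}
    (hy : x + s • d ∈ Q) :
    HasDerivAt (fun s : ℝ => f (x + s • d)) (fderiv ℝ f (x + s • d) d) s := by
  have hl : HasDerivAt (fun s : ℝ => x + s • d) d s := by
    simpa using ((hasDerivAt_id s).smul_const d).const_add x
  exact (((hf.contDiffAt hy).differentiableAt (by norm_num)).hasFDerivAt).comp_hasDerivAt s hl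

/-- Differentiate the symmetry of the Hessian in the direction `u`; openness of `Q` makes it
available near `y`. -/
lemma IsSelfConcordantOn.thirdDeriv_symm₂₃ (hf : IsSelfConcordantOn Q f M) {y : F} (hy : y ∈ Q)
    (u v w : F) : thirdDeriv f y u v w = thirdDeriv f y u w v := by
  have hy0 : y + (0 : ℝ) • u ∈ Q := by simpa using hy
  have h1 := hf.hasDerivAt_hessian_line hy0 v w
  have h2 := hf.hasDerivAt_hessian_line hy0 w v
  have hev : (fun s : ℝ => hessian f (y + s • u) v w) =ᶠ[nhds 0]
      fun s : ℝ => hessian f (y + s • u) w v := by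
    have hc : ContinuousAt (fun s : ℝ => y + s • u) 0 := by fun_prop
    filter_upwards [hc.preimage_mem_nhds (hf.isOpen.mem_nhds hy0)] with s hs
    exact hf.hessian_symm hs v w
  simpa using h1.unique (h2.congr_of_eventuallyEq hev)

lemma IsSelfConcordantOn.abs_thirdDeriv_apply_le (hf : IsSelfConcordantOn Q f M) {y : F}
    (hy : y ∈ Q) (hpos : ∀ v, v ≠ 0 → 0 < hessian f y v v) (u v : F) :
    |thirdDeriv f y u v v| ≤ 2 * M * localNorm f y u * hessian f y v v := by
  refine abs_trilinear_le (hf.hessian_symm hy) hpos (hf.thirdDeriv_symm₁₂ hy)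
    (hf.thirdDeriv_symm₂₃ hy) (by linarith [hf.nonneg]) (fun w => ?_) u v
  refine (hf.abs_thirdDeriv_le y hy w).trans_eq ?_
  have hw : 0 ≤ hessian f y w w := by
    rcases eq_or_ne w 0 with rfl | hw
    · simp
    · exact (hpos w hw).le
  rw [Real.sqrt_eq_rpow, ← Real.rpow_natCast, ← Real.rpow_mul hw]
  norm_num

end Calculus

/-! ### Comparison of local norms along a segment -/

section Line

variable {F : Type*} [NormedAddCommGroup F] [NormedSpace ℝ F] {Q : Set F} {f : F → ℝ} {M : ℝ}
  {x d : F} {b : ℝ}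

lemma localNorm_sq (hpos : ∀ v, v ≠ 0 → 0 < hessian f x v v) (v : F) :
    localNorm f x v ^ 2 = hessian f x v v := by
  refine Real.sq_sqrt ?_
  rcases eq_or_ne v 0 with rfl | hv
  · simp
  · exact (hpos v hv).le

lemma one_sub_mul_pos (hM : 0 ≤ M * localNorm f x d) (hρ : M * localNorm f x d < 1) (hb : b ≤ 1)
    {s : ℝ} (hs : s ∈ Set.Icc 0 b) : 0 < 1 - M * localNorm f x d * s := by
  nlinarith [hs.1, hs.2]

lemma IsSelfConcordantOn.mul_localNorm_nonneg (hf : IsSelfConcordantOn Q f M) (y v : F) :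
    0 ≤ M * localNorm f y v :=
  mul_nonneg hf.nonneg (Real.sqrt_nonneg _)

/-- Along a segment the local norm of its direction grows at most hyperbolically. -/
lemma IsSelfConcordantOn.localNorm_direction_le (hf : IsSelfConcordantOn Q f M)
    (hpos : ∀ y ∈ Q, ∀ v : F, v ≠ 0 → 0 < hessian f y v v)
    (hseg : ∀ s ∈ Set.Icc 0 b, x + s • d ∈ Q) {s : ℝ} (hs : s ∈ Set.Icc 0 b) :
    localNorm f (x + s • d) d * (1 - M * localNorm f x d * s) ≤ localNorm f x d := by
  rcases eq_or_ne d 0 with rfl | hd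
  · simp [localNorm]
  have hφ : ∀ s ∈ Set.Icc 0 b, 0 < localNorm f (x + s • d) d := fun s hs =>
    Real.sqrt_pos.2 (hpos _ (hseg s hs) d hd)
  -- For `φ(s)` the local norm of `d` at `x + s • d`, self-concordance reads `φ' ≤ M φ²`, so `1/φ +
  -- M s` is nondecreasing.
  have hder : ∀ s ∈ Set.Icc 0 b, HasDerivAt
      (fun s : ℝ => (localNorm f (x + s • d) d)⁻¹ + M * s)
      (-(thirdDeriv f (x + s • d) d d d / (2 * localNorm f (x + s • d) d)) /
        localNorm f (x + s • d) d ^ 2 + M) s := fun s hs => by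
    have h1 := ((hf.hasDerivAt_hessian_line (hseg s hs) d d).sqrt
      (hpos _ (hseg s hs) d hd).ne').inv (hφ s hs).ne'
    have h2 := h1.add ((hasDerivAt_id s).const_mul M)
    rw [mul_one] at h2
    exact h2
  have hmono : MonotoneOn (fun s : ℝ => (localNorm f (x + s • d) d)⁻¹ + M * s) (Set.Icc 0 b) := by
    refine monotoneOn_of_deriv_nonneg (convex_Icc 0 b)
      (fun s hs => (hder s hs).continuousAt.continuousWithinAt)
      (fun s hs => (hder s (interior_subset hs)).differentiableAt.differentiableWithinAt)
      fun s hs => ?_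
    have hs' := interior_subset hs
    rw [(hder s hs').deriv]
    have h3 := (le_abs_self _).trans
      (hf.abs_thirdDeriv_apply_le (hseg s hs') (hpos _ (hseg s hs')) d d)
    rw [← localNorm_sq (hpos _ (hseg s hs'))] at h3
    have h4 := hφ s hs'
    generalize localNorm f (x + s • d) d = n at *
    have : thirdDeriv f (x + s • d) d d d / (2 * n) / n ^ 2 ≤ M := by
      rw [div_div, div_le_iff₀ (by positivity)]
      linarith
    rw [neg_div]
    linarith
  have h0 : (0 : ℝ) ∈ Set.Icc 0 b := ⟨le_rfl, hs.1.trans hs.2⟩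
  have h1 := hmono h0 hs hs.1
  have h2 := hφ 0 h0
  have h3 := hφ s hs
  simp only [zero_smul, add_zero, mul_zero] at h1 h2
  generalize localNorm f (x + s • d) d = n at *
  generalize localNorm f x d = m at *
  have := mul_le_mul_of_nonneg_left h1 (mul_pos h2 h3).le
  have e1 : m * n * m⁻¹ = n := by field_simp
  have e2 : m * n * (n⁻¹ + M * s) = m + m * n * M * s := by field_simp
  rw [e1, e2] at this
  linarith

/-- Abstract two-sided Gronwall bound with hyperbolic rate. -/
lemma hyperbolic_gronwall {ψ ψ' : ℝ → ℝ} {ρ b : ℝ} (hρ : ∀ s ∈ Set.Icc 0 b, 0 < 1 - ρ * s)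
    (hψ : ∀ s ∈ Set.Icc 0 b, HasDerivAt ψ (ψ' s) s)
    (hb : ∀ s ∈ Set.Icc 0 b, |ψ' s| * (1 - ρ * s) ≤ 2 * ρ * ψ s) {s : ℝ} (hs : s ∈ Set.Icc 0 b) :
    ψ s * (1 - ρ * s) ^ 2 ≤ ψ 0 ∧ ψ 0 * (1 - ρ * s) ^ 2 ≤ ψ s := by
  have h0 : (0 : ℝ) ∈ Set.Icc 0 b := ⟨le_rfl, hs.1.trans hs.2⟩
  have hlin : ∀ s : ℝ, HasDerivAt (fun s : ℝ => (1 - ρ * s) ^ 2) (-(2 * ρ * (1 - ρ * s))) s := by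
    intro s
    have h1 : HasDerivAt (fun s : ℝ => 1 - ρ * s) (-ρ) s := by
      simpa using ((hasDerivAt_id s).const_mul ρ).const_sub 1
    refine (h1.pow 2).congr_deriv ?_
    push_cast
    ring
  -- The rate `2ρ/(1 - ρs)` is the logarithmic derivative of `(1 - ρs)⁻²`; monotonicity of a product
  -- and of a quotient replaces the logarithm, so `ψ` may vanish.
  constructor
  · have hder : ∀ s ∈ Set.Icc 0 b, HasDerivAt (fun s => ψ s * (1 - ρ * s) ^ 2)
        (ψ' s * (1 - ρ * s) ^ 2 + ψ s * -(2 * ρ * (1 - ρ * s))) s :=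
      fun s hs => (hψ s hs).mul (hlin s)
    have hanti : AntitoneOn (fun s => ψ s * (1 - ρ * s) ^ 2) (Set.Icc 0 b) := by
      refine antitoneOn_of_deriv_nonpos (convex_Icc 0 b)
        (fun s hs => (hder s hs).continuousAt.continuousWithinAt)
        (fun s hs => (hder s (interior_subset hs)).differentiableAt.differentiableWithinAt)
        fun s hs => ?_
      have hs' := interior_subset hs
      rw [(hder s hs').deriv]
      nlinarith [mul_le_mul_of_nonneg_right ((mul_le_mul_of_nonneg_right (le_abs_self (ψ' s))
        (hρ s hs').le).trans (hb s hs')) (hρ s hs').le]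
    simpa using hanti h0 hs hs.1
  · have hder : ∀ s ∈ Set.Icc 0 b, HasDerivAt (fun s => ψ s / (1 - ρ * s) ^ 2)
        ((ψ' s * (1 - ρ * s) ^ 2 - ψ s * -(2 * ρ * (1 - ρ * s))) / ((1 - ρ * s) ^ 2) ^ 2) s :=
      fun s hs => (hψ s hs).div (hlin s) (pow_pos (hρ s hs) 2).ne'
    have hmono : MonotoneOn (fun s => ψ s / (1 - ρ * s) ^ 2) (Set.Icc 0 b) := by
      refine monotoneOn_of_deriv_nonneg (convex_Icc 0 b)
        (fun s hs => (hder s hs).continuousAt.continuousWithinAt)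
        (fun s hs => (hder s (interior_subset hs)).differentiableAt.differentiableWithinAt)
        fun s hs => ?_
      have hs' := interior_subset hs
      rw [(hder s hs').deriv]
      refine div_nonneg ?_ (by positivity)
      nlinarith [mul_le_mul_of_nonneg_right ((mul_le_mul_of_nonneg_right (neg_abs_le (ψ' s))
        (hρ s hs').le)) (hρ s hs').le, mul_le_mul_of_nonneg_right (hb s hs') (hρ s hs').le]
    have := hmono h0 hs hs.1
    simp only [mul_zero, sub_zero, one_pow, div_one] at this
    rwa [le_div_iff₀ (pow_pos (hρ s hs) 2)] at this

/-- Comparison of Hessians along a segment of local length less than `1 / M`. -/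
lemma IsSelfConcordantOn.hessian_line_bounds (hf : IsSelfConcordantOn Q f M)
    (hpos : ∀ y ∈ Q, ∀ v : F, v ≠ 0 → 0 < hessian f y v v) (hρ : M * localNorm f x d < 1)
    (hb : b ≤ 1) (hseg : ∀ s ∈ Set.Icc 0 b, x + s • d ∈ Q) {s : ℝ} (hs : s ∈ Set.Icc 0 b)
    (v : F) :
    hessian f (x + s • d) v v * (1 - M * localNorm f x d * s) ^ 2 ≤ hessian f x v v ∧
      hessian f x v v * (1 - M * localNorm f x d * s) ^ 2 ≤ hessian f (x + s • d) v v := by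
  have hp : ∀ s ∈ Set.Icc 0 b, 0 < 1 - M * localNorm f x d * s := fun s hs =>
    one_sub_mul_pos (hf.mul_localNorm_nonneg x d) hρ hb hs
  have := hyperbolic_gronwall (ψ := fun s => hessian f (x + s • d) v v)
    (ψ' := fun s => thirdDeriv f (x + s • d) d v v) hp
    (fun s hs => hf.hasDerivAt_hessian_line (hseg s hs) v v) (fun s hs => ?_) hs
  · simpa using this
  · have h1 := hf.abs_thirdDeriv_apply_le (hseg s hs) (hpos _ (hseg s hs)) d v
    have h2 := hf.localNorm_direction_le hpos hseg hs
    have h3 : 0 ≤ hessian f (x + s • d) v v := by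
      rw [← localNorm_sq (hpos _ (hseg s hs))]; positivity
    calc _ ≤ 2 * M * localNorm f (x + s • d) d * hessian f (x + s • d) v v *
          (1 - M * localNorm f x d * s) := mul_le_mul_of_nonneg_right h1 (hp s hs).le
      _ = (2 * M * hessian f (x + s • d) v v) *
          (localNorm f (x + s • d) d * (1 - M * localNorm f x d * s)) := by ring
      _ ≤ (2 * M * hessian f (x + s • d) v v) * localNorm f x d :=
          mul_le_mul_of_nonneg_left h2 (mul_nonneg (by linarith [hf.nonneg]) h3)
      _ = _ := by ring

lemma IsSelfConcordantOn.localNorm_line_bounds (hf : IsSelfConcordantOn Q f M)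
    (hpos : ∀ y ∈ Q, ∀ v : F, v ≠ 0 → 0 < hessian f y v v) (hρ : M * localNorm f x d < 1)
    (hb : b ≤ 1) (hseg : ∀ s ∈ Set.Icc 0 b, x + s • d ∈ Q) {s : ℝ} (hs : s ∈ Set.Icc 0 b)
    (v : F) :
    localNorm f (x + s • d) v * (1 - M * localNorm f x d * s) ≤ localNorm f x v ∧
      localNorm f x v * (1 - M * localNorm f x d * s) ≤ localNorm f (x + s • d) v := by
  have hp := one_sub_mul_pos (hf.mul_localNorm_nonneg x d) hρ hb hs
  have hx : x ∈ Q := by simpa using hseg 0 ⟨le_rfl, hs.1.trans hs.2⟩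
  have h := hf.hessian_line_bounds hpos hρ hb hseg hs v
  rw [← localNorm_sq (hpos _ (hseg s hs)), ← localNorm_sq (hpos _ hx), ← mul_pow, ← mul_pow] at h
  exact ⟨(abs_le_of_sq_le_sq' h.1 (Real.sqrt_nonneg _)).2,
    (abs_le_of_sq_le_sq' h.2 (Real.sqrt_nonneg _)).2⟩

end Line

/-! ### The Dikin ellipsoid and the linearization of the gradient -/

section Dikin

variable {F : Type*} [NormedAddCommGroup F] [NormedSpace ℝ F] {Q : Set F} {f : F → ℝ} {M : ℝ}
  {x d : F}

lemma segment_mem_of_convex (hQ : Convex ℝ Q) (hx : x ∈ Q) {b : ℝ} (hb : x + b • d ∈ Q) :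
    ∀ s ∈ Set.Icc 0 b, x + s • d ∈ Q := by
  intro s hs
  rcases (hs.1.trans hs.2).eq_or_lt with h0 | h0
  · have : s = 0 := le_antisymm (hs.2.trans h0.ge) hs.1
    simpa [this] using hx
  · have := hQ.add_smul_mem hx hb (t := s / b)
      ⟨div_nonneg hs.1 h0.le, div_le_one_of_le₀ hs.2 h0.le⟩
    rwa [smul_smul, div_mul_cancel₀ _ h0.ne'] at this

/-- On a segment of local length less than `1 / M` the function stays bounded, uniformly in the
length of the part of the segment that lies in the domain. -/
lemma IsSelfConcordantOn.line_le (hf : IsSelfConcordantOn Q f M)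
    (hpos : ∀ y ∈ Q, ∀ v : F, v ≠ 0 → 0 < hessian f y v v) (hρ : M * localNorm f x d < 1)
    {b : ℝ} (hb0 : 0 ≤ b) (hb : b ≤ 1) (hseg : ∀ s ∈ Set.Icc 0 b, x + s • d ∈ Q) :
    f (x + b • d) ≤ f x + (|fderiv ℝ f x d| +
      hessian f x d d / (1 - M * localNorm f x d) ^ 2) := by
  -- The Hessian comparison factor is taken at its worst value, `s = 1`, so that `K` does not depend
  -- on `b`.
  set K := hessian f x d d / (1 - M * localNorm f x d) ^ 2 with hK
  have hx : x ∈ Q := by simpa using hseg 0 ⟨le_rfl, hb0⟩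
  have hd0 : 0 ≤ hessian f x d d := by rw [← localNorm_sq (hpos x hx)]; positivity
  have hK0 : 0 ≤ K := by positivity
  have hφ : ∀ s ∈ Set.Icc 0 b, ‖hessian f (x + s • d) d d‖ ≤ K := by
    intro s hs
    have h0 : 0 ≤ hessian f (x + s • d) d d := by
      rw [← localNorm_sq (hpos _ (hseg s hs))]; positivity
    rw [Real.norm_of_nonneg h0, hK, le_div_iff₀ (pow_pos (by linarith) 2)]
    refine le_trans (mul_le_mul_of_nonneg_left ?_ h0)
      (hf.hessian_line_bounds hpos hρ hb hseg hs d).1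
    refine pow_le_pow_left₀ (by linarith) ?_ 2
    nlinarith [hf.mul_localNorm_nonneg x d, hs.1, hs.2]
  have h1 : ∀ s ∈ Set.Icc 0 b, ‖fderiv ℝ f (x + s • d) d‖ ≤ |fderiv ℝ f x d| + K := by
    intro s hs
    have := norm_image_sub_le_of_norm_deriv_le_segment'
      (fun s hs => (hf.hasDerivAt_fderiv_line (hseg s hs) d).hasDerivWithinAt)
      (fun s hs => hφ s ⟨hs.1, hs.2.le⟩) s hs
    simp only [zero_smul, add_zero, sub_zero] at this
    have h2 := norm_le_norm_add_norm_sub' (fderiv ℝ f (x + s • d) d) (fderiv ℝ f x d)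
    rw [Real.norm_eq_abs (fderiv ℝ f x d)] at h2
    nlinarith [hs.1, hs.2]
  have h2 := norm_image_sub_le_of_norm_deriv_le_segment'
      (fun s hs => (hf.hasDerivAt_line (hseg s hs)).hasDerivWithinAt)
      (fun s hs => h1 s ⟨hs.1, hs.2.le⟩) b ⟨hb0, le_rfl⟩
  simp only [zero_smul, add_zero, sub_zero] at h2
  have h3 := (le_abs_self _).trans h2
  nlinarith [abs_nonneg (fderiv ℝ f x d)]

/-- The open Dikin ellipsoid is contained in the domain. -/
lemma IsSelfConcordantOn.add_smul_mem (hf : IsSelfConcordantOn Q f M)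
    (hpos : ∀ y ∈ Q, ∀ v : F, v ≠ 0 → 0 < hessian f y v v) (hx : x ∈ Q)
    (hρ : M * localNorm f x d < 1) : ∀ s ∈ Set.Icc (0 : ℝ) 1, x + s • d ∈ Q := by
  have hcont : Continuous fun s : ℝ => x + s • d := by fun_prop
  set a := f x + (|fderiv ℝ f x d| + hessian f x d d / (1 - M * localNorm f x d) ^ 2) with ha
  refine IsClosed.Icc_subset_of_forall_exists_gt (s := {s : ℝ | x + s • d ∈ Q}) ?_
    (by simpa using hx) ?_
  -- By the uniform bound `a`, membership in `Q` on this segment amounts to membership in one closed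
  -- sublevel set. Openness of `Q` then continues the segment up to `1`.
  · have : {s : ℝ | x + s • d ∈ Q} ∩ Set.Icc 0 1 =
        ((fun s : ℝ => x + s • d) ⁻¹' {y | y ∈ Q ∧ f y ≤ a}) ∩ Set.Icc 0 1 := by
      ext s
      refine ⟨fun h => ⟨⟨h.1, ?_⟩, h.2⟩, fun h => ⟨h.1.1, h.2⟩⟩
      exact hf.line_le hpos hρ h.2.1 h.2.2 (segment_mem_of_convex hf.convexOn.1 hx h.1)
    rw [this]
    exact ((hf.isClosed_sublevel a).preimage hcont).inter isClosed_Icc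
  · intro s hs y hy
    have h1 : ∀ᶠ u in nhdsWithin s (Set.Ioi s), x + u • d ∈ Q :=
      nhdsWithin_le_nhds ((hf.isOpen.preimage hcont).mem_nhds hs.1)
    obtain ⟨u, hu, hu'⟩ := (h1.and (Ioc_mem_nhdsGT hy)).exists
    exact ⟨u, hu, hu'⟩

/-- The error of the linearization of the gradient. -/
lemma IsSelfConcordantOn.abs_fderiv_sub_le (hf : IsSelfConcordantOn Q f M)
    (hpos : ∀ y ∈ Q, ∀ v : F, v ≠ 0 → 0 < hessian f y v v) (hx : x ∈ Q)
    (hρ : M * localNorm f x d < 1) (v : F) :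
    |fderiv ℝ f (x + d) v - fderiv ℝ f x v - hessian f x d v| ≤
      M * localNorm f x d ^ 2 / (1 - M * localNorm f x d) * localNorm f x v := by
  have hseg := hf.add_smul_mem hpos hx hρ
  have hp : ∀ s ∈ Set.Icc (0 : ℝ) 1, 0 < 1 - M * localNorm f x d * s := fun s hs =>
    one_sub_mul_pos (hf.mul_localNorm_nonneg x d) hρ le_rfl hs
  set r := localNorm f x d with hr
  set n := localNorm f x v with hn
  have hr0 : 0 ≤ r := Real.sqrt_nonneg _
  have hn0 : 0 ≤ n := Real.sqrt_nonneg _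
  have hlin : ∀ s : ℝ, HasDerivAt (fun s : ℝ => 1 - M * r * s) (-(M * r)) s := fun s => by
    simpa using ((hasDerivAt_id s).const_mul (M * r)).const_sub 1
  -- This majorant is integrated twice from `0`: first to `1/(1 - Mrs)² - 1`, then to `s/(1 - Mrs) -
  -- s`, each times `n * r`.
  have hT : ∀ s ∈ Set.Icc (0 : ℝ) 1,
      |thirdDeriv f (x + s • d) d d v| ≤ n * r * (2 * (M * r) / (1 - M * r * s) ^ 3) := by
    intro s hs
    have h1 := hf.abs_thirdDeriv_apply_le (hseg s hs) (hpos _ (hseg s hs)) v d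
    have h2 := (hf.localNorm_line_bounds hpos hρ le_rfl hseg hs d).1
    have h3 := (hf.localNorm_line_bounds hpos hρ le_rfl hseg hs v).1
    -- The polarized bound needs the repeated vector `d` in the last two slots.
    rw [hf.thirdDeriv_symm₂₃ (hseg s hs), hf.thirdDeriv_symm₁₂ (hseg s hs)]
    refine h1.trans ?_
    rw [← localNorm_sq (hpos _ (hseg s hs))]
    rw [← le_div_iff₀ (hp s hs)] at h2 h3
    have h4 : 0 ≤ localNorm f (x + s • d) d := Real.sqrt_nonneg _
    have h5 : 0 ≤ localNorm f (x + s • d) v := Real.sqrt_nonneg _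
    have hM := hf.nonneg
    have h6 := (hp s hs).le
    calc 2 * M * localNorm f (x + s • d) v * localNorm f (x + s • d) d ^ 2
        ≤ 2 * M * (n / (1 - M * r * s)) * (r / (1 - M * r * s)) ^ 2 := by
          gcongr
      _ = _ := by
          have := (hp s hs).ne'
          field_simp
  have hH : ∀ s ∈ Set.Icc (0 : ℝ) 1,
      ‖hessian f (x + s • d) d v - hessian f x d v‖ ≤
        n * r * (1 / (1 - M * r * s) ^ 2 - 1) := by
    have hB : ∀ s ∈ Set.Icc (0 : ℝ) 1, HasDerivAt
        (fun s : ℝ => n * r * (1 / (1 - M * r * s) ^ 2 - 1))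
        (n * r * (2 * (M * r) / (1 - M * r * s) ^ 3)) s := fun s hs => by
      have hne := (hp s hs).ne'
      have h1 := ((hlin s).pow 2).inv (pow_ne_zero 2 hne)
      have h2 := (h1.sub_const 1).const_mul (n * r)
      simp only [one_div]
      refine h2.congr_deriv ?_
      push_cast
      simp only [Pi.pow_apply]
      field_simp
    have hD : ∀ s ∈ Set.Icc (0 : ℝ) 1, HasDerivAt
        (fun s : ℝ => hessian f (x + s • d) d v - hessian f x d v)
        (thirdDeriv f (x + s • d) d d v) s := fun s hs =>
      (hf.hasDerivAt_hessian_line (hseg s hs) d v).sub_const _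
    intro s hs
    exact image_norm_le_of_norm_deriv_right_le_deriv_boundary'
      (fun s hs => (hD s hs).continuousAt.continuousWithinAt)
      (fun s hs => (hD s ⟨hs.1, hs.2.le⟩).hasDerivWithinAt) (by simp)
      (fun s hs => (hB s hs).continuousAt.continuousWithinAt)
      (fun s hs => (hB s ⟨hs.1, hs.2.le⟩).hasDerivWithinAt)
      (fun s hs => hT s ⟨hs.1, hs.2.le⟩) hs
  have hB : ∀ s ∈ Set.Icc (0 : ℝ) 1, HasDerivAt
      (fun s : ℝ => n * r * (s / (1 - M * r * s) - s))
      (n * r * (1 / (1 - M * r * s) ^ 2 - 1)) s := fun s hs => by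
    have hne := (hp s hs).ne'
    refine ((((hasDerivAt_id s).div (hlin s) hne).sub (hasDerivAt_id s)).const_mul
      (n * r)).congr_deriv ?_
    simp only [id]
    field_simp
    ring
  have hD : ∀ s ∈ Set.Icc (0 : ℝ) 1, HasDerivAt
      (fun s : ℝ => fderiv ℝ f (x + s • d) v - fderiv ℝ f x v - hessian f x d v * s)
      (hessian f (x + s • d) d v - hessian f x d v) s := fun s hs => by
    refine (((hf.hasDerivAt_fderiv_line (hseg s hs) v).sub_const _).sub
      ((hasDerivAt_id s).const_mul (hessian f x d v))).congr_deriv ?_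
    rw [mul_one]
  have := image_norm_le_of_norm_deriv_right_le_deriv_boundary'
      (fun s hs => (hD s hs).continuousAt.continuousWithinAt)
      (fun s hs => (hD s ⟨hs.1, hs.2.le⟩).hasDerivWithinAt) (by simp)
      (fun s hs => (hB s hs).continuousAt.continuousWithinAt)
      (fun s hs => (hB s ⟨hs.1, hs.2.le⟩).hasDerivWithinAt)
      (fun s hs => hH s ⟨hs.1, hs.2.le⟩) (Set.right_mem_Icc.2 zero_le_one)
  simp only [one_smul, mul_one, Real.norm_eq_abs] at this
  refine this.trans_eq ?_
  have hne : 1 - M * r ≠ 0 := by linarith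
  rw [show 1 / (1 - M * r) - 1 = M * r / (1 - M * r) by
    rw [eq_div_iff hne, sub_mul, one_div, inv_mul_cancel₀ hne]; ring]
  ring

/-! ### Linear perturbations and the main estimate -/

lemma IsSelfConcordantOn.fderiv_pathFunction (hf : IsSelfConcordantOn Q f M) {y : F} (hy : y ∈ Q)
    (c : F →L[ℝ] ℝ) (t : ℝ) : fderiv ℝ (pathFunction f c t) y = fderiv ℝ f y + t • c :=
  ((((hf.contDiffAt hy).differentiableAt (by norm_num)).hasFDerivAt).add
    (c.hasFDerivAt.const_smul t)).fderiv

lemma IsSelfConcordantOn.hessian_pathFunction (hf : IsSelfConcordantOn Q f M) {y : F} (hy : y ∈ Q)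
    (c : F →L[ℝ] ℝ) (t : ℝ) : hessian (pathFunction f c t) y = hessian f y := by
  have : fderiv ℝ (pathFunction f c t) =ᶠ[nhds y] fun z => fderiv ℝ f z + t • c := by
    filter_upwards [hf.isOpen.mem_nhds hy] with z hz using hf.fderiv_pathFunction hz c t
  rw [hessian, this.fderiv_eq, fderiv_add_const]
  rfl

lemma IsSelfConcordantOn.newtonDecrement_pathFunction (hf : IsSelfConcordantOn Q f M) {y : F}
    (hy : y ∈ Q) (c : F →L[ℝ] ℝ) (t : ℝ) :
    newtonDecrement (pathFunction f c t) y = dualNorm f y (fderiv ℝ f y + t • c) := by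
  rw [newtonDecrement, dualNorm, dualNorm, invHessian, invHessian, hf.hessian_pathFunction hy,
    hf.fderiv_pathFunction hy]

end Dikin

end SelfConcordance

end

theorem mainTheorem6 {E : Type*} [NormedAddCommGroup E] [NormedSpace ℝ E] [FiniteDimensional ℝ E]
    (Q : Set E) (f : E → ℝ) (M : ℝ) (hf : SelfConcordance.IsSelfConcordantOn Q f M)
    (hpos : ∀ y ∈ Q, ∀ v : E, v ≠ 0 → 0 < SelfConcordance.hessian f y v v)
    (c : E →L[ℝ] ℝ) (x : E) (hx : x ∈ Q) (h : E) (hh : h = SelfConcordance.invHessian f x c)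
    (r : ℝ) (hr : r = SelfConcordance.localNorm f x h) :
    r = SelfConcordance.dualNorm f x c ∧
    ∀ t τ : ℝ, |τ| * M * r < 1 →
      x + τ • h ∈ Q ∧
      SelfConcordance.newtonDecrement (SelfConcordance.pathFunction f c (t - τ)) (x + τ • h) ≤
        SelfConcordance.newtonDecrement (SelfConcordance.pathFunction f c t) x *
            (1 + |τ| * M * r / (1 - |τ| * M * r)) +
          1 / M * (|τ| * M * r / (1 - |τ| * M * r)) ^ 2 := by
  have hposx := hpos x hx
  have hHh : SelfConcordance.hessian f x h = c := by
    rw [hh, SelfConcordance.hessian_invHessian hposx]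
  have hM := hf.nonneg
  refine ⟨by rw [hr, SelfConcordance.localNorm, SelfConcordance.dualNorm, ← hh, hHh],
    fun t τ hτ => ?_⟩
  have hd : SelfConcordance.localNorm f x (τ • h) = |τ| * r := by
    rw [hr, SelfConcordance.localNorm, SelfConcordance.localNorm, ← Real.sqrt_sq_eq_abs,
      ← Real.sqrt_mul (sq_nonneg τ)]
    congr 1
    simp only [map_smul, _root_.smul_apply, smul_eq_mul]
    ring
  have hρ : M * SelfConcordance.localNorm f x (τ • h) < 1 := by rw [hd]; linarith
  have hseg := hf.add_smul_mem hpos hx hρ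
  have hone : (1 : ℝ) ∈ Set.Icc (0 : ℝ) 1 := Set.right_mem_Icc.2 zero_le_one
  have hy : x + τ • h ∈ Q := by simpa using hseg 1 hone
  refine ⟨hy, ?_⟩
  rw [hf.newtonDecrement_pathFunction hy, hf.newtonDecrement_pathFunction hx]
  set l := SelfConcordance.dualNorm f x (fderiv ℝ f x + t • c) with hl
  have hl0 : 0 ≤ l := Real.sqrt_nonneg _
  have hr0 : 0 ≤ r := by rw [hr]; exact Real.sqrt_nonneg _
  have hp : 0 < 1 - |τ| * M * r := by linarith
  -- With `p = |τ| * M * r`, this is `1 + p/(1-p) = 1/(1-p)` and `p²/M = M(|τ|r)²`. For `M = 0` the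
  -- convention `1 / 0 = 0` makes both sides `l`.
  have hbound : l * (1 + |τ| * M * r / (1 - |τ| * M * r)) +
      1 / M * (|τ| * M * r / (1 - |τ| * M * r)) ^ 2 =
      (l + M * (|τ| * r) ^ 2 / (1 - M * (|τ| * r))) / (1 - |τ| * M * r) := by
    have e : M * (|τ| * r) = |τ| * M * r := by ring
    have hne := hp.ne'
    rw [e]
    rcases hM.eq_or_lt with h0 | h0
    · simp [← h0]
    · field_simp
      ring
  rw [hbound]
  have hC : 0 ≤ l + M * (|τ| * r) ^ 2 / (1 - M * (|τ| * r)) :=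
    add_nonneg hl0 (div_nonneg (by positivity) (by linarith))
  refine SelfConcordance.dualNorm_le (hpos _ hy) (div_nonneg hC hp.le) fun v => ?_
  have h1 := hf.abs_fderiv_sub_le hpos hx hρ v
  have h2 := SelfConcordance.abs_apply_le_dualNorm_mul (hf.hessian_symm hx) hposx
    (fderiv ℝ f x + t • c) v
  have h3 := (hf.localNorm_line_bounds hpos hρ le_rfl hseg hone v).2
  simp only [one_smul, mul_one] at h3
  rw [hd] at h1 h3
  rw [map_smul, hHh] at h1
  have h4 : SelfConcordance.localNorm f x v ≤
      SelfConcordance.localNorm f (x + τ • h) v / (1 - |τ| * M * r) := by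
    rw [le_div_iff₀ hp]
    linarith
  -- The shift of `t` by `-τ` supplies the `-τ • c` that turns the gradient difference into a
  -- linearization error.
  have h5 : (fderiv ℝ f (x + τ • h) + (t - τ) • c) v = (fderiv ℝ f x + t • c) v +
      (fderiv ℝ f (x + τ • h) v - fderiv ℝ f x v - (τ • c) v) := by
    simp only [_root_.add_apply, _root_.smul_apply, smul_eq_mul]
    ring
  rw [h5]
  calc _ ≤ l * SelfConcordance.localNorm f x v + M * (|τ| * r) ^ 2 / (1 - M * (|τ| * r)) *
        SelfConcordance.localNorm f x v := (abs_add_le _ _).trans (add_le_add h2 h1)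
    _ = (l + M * (|τ| * r) ^ 2 / (1 - M * (|τ| * r))) * SelfConcordance.localNorm f x v := by ring
    _ ≤ (l + M * (|τ| * r) ^ 2 / (1 - M * (|τ| * r))) *
        (SelfConcordance.localNorm f (x + τ • h) v / (1 - |τ| * M * r)) :=
      mul_le_mul_of_nonneg_left h4 hC
    _ = _ := by ring
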